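/- Theorem. Consider online $b$-matching with stochastic rewards. An instance is a finite bipartite graph $G=(S\cup R,E)$ with a fixed order of arrival of the requests $r\in R$ and a success probability $p_{s,r}\in[0,1]$ for each edge $\{s,r\}\in E$ (arbitrary, not necessarily equal or small). Every server $s\in S$ has the same capacity $b\in\mathbb{N}$, $b\ge 1$. When a request $r$ arrives, it may be assigned to an available server, that is, to a neighbor with fewer than $b$ successful matches so far. An assignment of $r$ to $s$ becomes a successful match with probability $p_{s,r}$, independently of the past, and its outcome is revealed at once; a failed assignment uses no capacity. The load $l_s$ of a server is the sum of the probabilities $p_{s,r}$ of all requests $r$ assigned to $s$ so far, successfully or not. Generalized StochasticBalance assigns each arriving request $r$ to an available neighbor $s$ that maximizes $p_{s,r}\,(1-f(l_s))$, where $f(x)=e^{x/b-1}$ for $x\le b$ and $f(x)=1$ for $x>b$; ties are broken arbitrarily, and $r$ is left unassigned only if it has no available neighbor. Let $\mathbb{E}[\mathrm{SBal}(G)]$ be its expected number of successful matches. Let $\mathrm{Opt}(G)$ be the maximum of $\sum_{\{s,r\}\in E}p_{s,r}\,m(s,r)$ over all $m\colon E\to[0,\infty)$ with $\sum_{r:\{s,r\}\in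 E}p_{s,r}\,m(s,r)\le b$ for all $s\in S$ and $\sum_{s:\{s,r\}\in E}m(s,r)\le 1$ for all $r\in R$ (the non-stochastic benchmark). Let $\mathrm{SOpt}(G)$ be the maximum expected number of successful matches among all algorithms that know $G$ and all edge probabilities in advance, serve the requests in their order of arrival, assign each request to at most one available neighbor, and learn the outcome of an assignment only after making it (the stochastic benchmark). Then there is a sequence $(\varepsilon_b)_{b\ge 1}$ of real numbers with $\varepsilon_b\to 0$ as $b\to\infty$ such that, for every $b\ge 1$, every instance $G$ with uniform capacity $b$ and every way of breaking ties, $$\mathbb{E}[\mathrm{SBal}(G)]\ \ge\ (1-\varepsilon_b)\Bigl(1-\frac1e\Bigr)\mathrm{Opt}(G)\qquad\text{and}\qquad \mathbb{E}[\mathrm{SBal}(G)]\ \ge\ (1-\varepsilon_b)\Bigl(1-\frac1e\Bigr)\mathrm{SOpt}(G).$$ -/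

import Mathlib

noncomputable section

namespace StochasticMatching

/-- The input graph of online matching with stochastic rewards: a finite bipartite graph with
server set `S` and requests `0, 1, …, n - 1`, listed in their order of arrival, with a success
probability `p s r ∈ [0, 1]` for each edge. The value of `p` at non-adjacent pairs is never used. -/
structure RewardGraph (S : Type*) (n : ℕ) where
  Adj : S → Fin n → Prop
  p : S → Fin n → unitInterval

/-- What has happened to the first `t` requests: `none` if the request was not assigned,
`some (s, true)` if it was assigned to `s` and the assignment succeeded, `some (s, false)` if it was
assigned to `s` and the assignment failed. -/
abbrev History (S : Type*) (t : ℕ) : Type _ := Fin t → Option (S × Bool)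

/-- A (possibly randomized) decision rule: given the history of all earlier requests, it chooses a
server for the current request, or `none` to leave the request unassigned. -/
abbrev Policy (S : Type*) (n : ℕ) : Type _ := (t : Fin n) → History S t → PMF (Option S)

/-- The coin that shows `true` with probability `q` and `false` with probability `1 - q`. -/
def coin (q : unitInterval) : PMF Bool :=
  PMF.ofFintype (fun x => cond x (ENNReal.ofReal q) (ENNReal.ofReal (1 - q))) (by
    have h0 : (0 : ℝ) ≤ q := q.2.1
    have h1 : (0 : ℝ) ≤ 1 - q := sub_nonneg.2 q.2.2
    simp [← ENNReal.ofReal_add h0 h1])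

open Classical in
/-- The number of successful matches of server `s` in a history. -/
def serverMatches {S : Type*} {t : ℕ} (h : History S t) (s : S) : ℕ :=
  (Finset.univ.filter fun i => h i = some (s, true)).card

open Classical in
/-- The total number of successful matches in a history. -/
def totalMatches {S : Type*} {t : ℕ} (h : History S t) : ℕ :=
  (Finset.univ.filter fun i => ∃ s, h i = some (s, true)).card

namespace RewardGraph

variable {S : Type*} {n : ℕ} (G : RewardGraph S n)

open Classical in
/-- The load of server `s` after `t` requests: the sum of the edge probabilities of the requests
assigned to `s`, successfully or not. -/
def load {t : ℕ} (ht : t ≤ n) (h : History S t) (s : S) : ℝ :=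
  ∑ i : Fin t, if ∃ x, h i = some (s, x) then (G.p s (Fin.castLE ht i) : ℝ) else 0

/-- The servers to which the current request `t` may be assigned: its neighbors with remaining
capacity. -/
def available (b : ℕ) (t : Fin n) (h : History S t) : Set S :=
  {s | G.Adj s t ∧ serverMatches h s < b}

/-- The policies allowed for capacity `b`: a request is only ever assigned to a neighbor with
remaining capacity. -/
def IsAdmissible (b : ℕ) (π : Policy S n) : Prop :=
  ∀ (t : Fin n) (h : History S t) (s : S), some s ∈ (π t h).support → s ∈ G.available b t h

/-- The random entry that the decision `a` for request `t` adds to the history. -/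
def outcome (t : Fin n) : Option S → PMF (Option (S × Bool))
  | none => PMF.pure none
  | some s => (coin (G.p s t)).map fun x => some (s, x)

/-- The law of the history after `t` requests under the policy `π`. -/
def law (π : Policy S n) : (t : ℕ) → t ≤ n → PMF (History S t)
  | 0, _ => PMF.pure Fin.elim0
  | t + 1, ht =>
    (law π t (Nat.le_of_succ_le ht)).bind fun h =>
      (π ⟨t, ht⟩ h).bind fun a =>
        (G.outcome ⟨t, ht⟩ a).map fun o => (Fin.snoc h o : History S (t + 1))

open Classical in
/-- The expected number of successful matches of the policy `π`. -/
def expectedMatches [Fintype S] (π : Policy S n) : ℝ :=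
  ∑ h : History S n, (G.law π n le_rfl h).toReal * (totalMatches h : ℝ)

end RewardGraph

/-- The function `f` of the generalized StochasticBalance algorithm for capacity `b`. -/
def balanceFun (b : ℕ) (x : ℝ) : ℝ :=
  if x ≤ b then Real.exp (x / b - 1) else 1

namespace RewardGraph

variable {S : Type*} {n : ℕ} (G : RewardGraph S n)

/-- `π` is generalized StochasticBalance, with some rule for breaking ties: the current request `t`
is left unassigned only if no neighbor has remaining capacity, and otherwise it is assigned to a
neighbor `s` with remaining capacity that maximizes `p s t * (1 - f (load s))`. Ties may be broken
in any way, also depending on the history or on extra randomness. -/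
def IsStochasticBalance (b : ℕ) (π : Policy S n) : Prop :=
  ∀ (t : Fin n) (h : History S t), ∀ a ∈ (π t h).support,
    match a with
    | none => G.available b t h = ∅
    | some s => s ∈ G.available b t h ∧ ∀ s' ∈ G.available b t h,
        (G.p s' t : ℝ) * (1 - balanceFun b (G.load t.isLt.le h s')) ≤
          (G.p s t : ℝ) * (1 - balanceFun b (G.load t.isLt.le h s))

open Classical in
/-- Feasible points of the budgeted allocation (fractional matching) linear program. -/
structure IsFeasible [Fintype S] (b : ℕ) (m : S → Fin n → ℝ) : Prop where
  nonneg : ∀ s r, G.Adj s r → 0 ≤ m s r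
  server : ∀ s, (∑ r : Fin n, if G.Adj s r then (G.p s r : ℝ) * m s r else 0) ≤ b
  request : ∀ r, (∑ s : S, if G.Adj s r then m s r else 0) ≤ 1

open Classical in
/-- The objective of the budgeted allocation linear program. -/
def lpValue [Fintype S] (m : S → Fin n → ℝ) : ℝ :=
  ∑ s : S, ∑ r : Fin n, if G.Adj s r then (G.p s r : ℝ) * m s r else 0

/-- The non-stochastic benchmark: the optimal value of the budgeted allocation linear program. -/
def opt [Fintype S] (b : ℕ) : ℝ :=
  sSup {v | ∃ m : S → Fin n → ℝ, G.IsFeasible b m ∧ v = G.lpValue m}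

/-- The stochastic benchmark: the best expected number of matches among all policies that serve the
requests in arrival order and learn the outcome of each assignment right after making it. A policy
is chosen for the given graph, hence it may use knowledge of the whole graph. -/
def sopt [Fintype S] (b : ℕ) : ℝ :=
  sSup {v | ∃ π : Policy S n, G.IsAdmissible b π ∧ v = G.expectedMatches π}

/- The suprema in the two benchmarks are those of bounded non-empty sets. -/

theorem opt_set_nonempty [Fintype S] (b : ℕ) :
    {v | ∃ m : S → Fin n → ℝ, G.IsFeasible b m ∧ v = G.lpValue m}.Nonempty :=
  ⟨_, 0, ⟨by simp, by simp, by simp⟩, rfl⟩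

theorem opt_set_bddAbove [Fintype S] (b : ℕ) :
    BddAbove {v | ∃ m : S → Fin n → ℝ, G.IsFeasible b m ∧ v = G.lpValue m} := by
  refine ⟨∑ _s : S, (b : ℝ), ?_⟩
  rintro v ⟨m, hm, rfl⟩
  exact Finset.sum_le_sum fun s _ => hm.server s

theorem sopt_set_nonempty [Fintype S] (b : ℕ) :
    {v | ∃ π : Policy S n, G.IsAdmissible b π ∧ v = G.expectedMatches π}.Nonempty :=
  ⟨_, fun _ _ => PMF.pure none, by intro t h s; simp, rfl⟩

theorem sopt_set_bddAbove [Fintype S] (b : ℕ) :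
    BddAbove {v | ∃ π : Policy S n, G.IsAdmissible b π ∧ v = G.expectedMatches π} := by
  classical
  refine ⟨∑ _h : History S n, (n : ℝ), ?_⟩
  rintro v ⟨π, -, rfl⟩
  refine Finset.sum_le_sum fun h _ => ?_
  have h1 : (G.law π n le_rfl h).toReal ≤ 1 := by
    simpa using ENNReal.toReal_mono ENNReal.one_ne_top (PMF.coe_le_one (G.law π n le_rfl) h)
  have h2 : (totalMatches h : ℝ) ≤ n := by
    have h3 : totalMatches h ≤ n := by
      unfold totalMatches
      exact (Finset.card_le_univ _).trans_eq (Fintype.card_fin n)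
    exact_mod_cast h3
  calc _ ≤ 1 * (n : ℝ) := by gcongr
    _ = n := one_mul _

end RewardGraph

end StochasticMatching

end

/-! The proof is a randomized primal-dual argument. Along every history, each unit of load put on
`s` is split: the share `f(l_s)` goes to the dual variable of `s` (scaled by `1/b`) and `1 - f(l_s)`
to that of the request. The dual objective is then the total load. Matches minus load is a
martingale, so the mean of this objective is the expected number of matches
(`expectedMatches_eq_mean`, `dual_value`).

Since `b f' = f` up to `b`, the dual variable of `s` is nearly `f(l_s) - 1/e` at the final load
(`le_serverDual`). If `s` was available to `r`, the greedy rule supplies the missing `1 - f(l_s)`.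
If not, `s` ends with exactly `b` matches, and `f(l_s)` is close to `1` unless the load deviates
from the number of matches. That deviation has mean at most `√b`, by a variance bound. Hence the
averaged dual variables satisfy every constraint up to the factor `1 - 1/e - 1/b - √b/b`, and weak
duality finishes. The stochastic benchmark lies below the linear program because assignment
probabilities are a feasible point. -/

noncomputable section

namespace StochasticMatching

/-! ### Expectations over finite types -/

section Mean

variable {α β γ : Type*} [Fintype α] [Fintype β] [Fintype γ]

/-- The expectation of a real function under a probability mass function on a finite type. -/
def mean (μ : PMF α) (F : α → ℝ) : ℝ := ∑ a, (μ a).toReal * F a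

theorem mean_pure (a : α) (F : α → ℝ) : mean (PMF.pure a) F = F a := by
  classical
  rw [mean, Finset.sum_eq_single a]
  · simp
  · intro x _ hx
    simp [PMF.pure_apply, hx]
  · simp

theorem mean_bind (μ : PMF α) (κ : α → PMF β) (F : β → ℝ) :
    mean (μ.bind κ) F = mean μ fun a => mean (κ a) F := by
  simp only [mean, PMF.bind_apply, tsum_fintype, Finset.mul_sum]
  rw [Finset.sum_comm]
  refine Finset.sum_congr rfl fun b _ => ?_
  rw [ENNReal.toReal_sum fun a _ => ENNReal.mul_ne_top (PMF.apply_ne_top _ _)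
    (PMF.apply_ne_top _ _), Finset.sum_mul]
  simp [mul_assoc]

theorem mean_map (μ : PMF α) (g : α → β) (F : β → ℝ) :
    mean (μ.map g) F = mean μ fun a => F (g a) := by
  rw [← PMF.bind_pure_comp, mean_bind]
  simp [mean_pure]

theorem mean_mono (μ : PMF α) {F H : α → ℝ} (h : ∀ a ∈ μ.support, F a ≤ H a) :
    mean μ F ≤ mean μ H := by
  refine Finset.sum_le_sum fun a _ => ?_
  by_cases ha : a ∈ μ.support
  · exact mul_le_mul_of_nonneg_left (h a ha) ENNReal.toReal_nonneg
  · rw [PMF.mem_support_iff, not_not] at ha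
    simp [ha]

theorem mean_congr (μ : PMF α) {F H : α → ℝ} (h : ∀ a ∈ μ.support, F a = H a) :
    mean μ F = mean μ H :=
  le_antisymm (mean_mono μ fun a ha => (h a ha).le) (mean_mono μ fun a ha => (h a ha).ge)

theorem mean_const (μ : PMF α) (c : ℝ) : mean μ (fun _ => c) = c := by
  have h : ∑ a, (μ a).toReal = 1 := by
    rw [← ENNReal.toReal_sum fun a _ => PMF.apply_ne_top _ _,
      ← tsum_fintype (L := .unconditional _),
      PMF.tsum_coe, ENNReal.toReal_one]
  rw [mean, ← Finset.sum_mul, h, one_mul]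

theorem mean_add (μ : PMF α) (F H : α → ℝ) :
    mean μ (fun a => F a + H a) = mean μ F + mean μ H := by
  simp [mean, mul_add, Finset.sum_add_distrib]

theorem mean_sub (μ : PMF α) (F H : α → ℝ) :
    mean μ (fun a => F a - H a) = mean μ F - mean μ H := by
  simp [mean, mul_sub, Finset.sum_sub_distrib]

theorem mean_const_mul (μ : PMF α) (c : ℝ) (F : α → ℝ) :
    mean μ (fun a => c * F a) = c * mean μ F := by
  simp [mean, Finset.mul_sum, mul_left_comm]

theorem mean_sum {ι : Type*} (μ : PMF α) (T : Finset ι) (F : ι → α → ℝ) :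
    mean μ (fun a => ∑ i ∈ T, F i a) = ∑ i ∈ T, mean μ (F i) := by
  simp only [mean, Finset.mul_sum]
  exact Finset.sum_comm

theorem mean_nonneg (μ : PMF α) {F : α → ℝ} (h : ∀ a, 0 ≤ F a) : 0 ≤ mean μ F :=
  Finset.sum_nonneg fun a _ => mul_nonneg ENNReal.toReal_nonneg (h a)

/-- The mean of the pointwise inequality `2√v |x| ≤ x² + v`. -/
theorem mean_abs_le_sqrt (μ : PMF α) (F : α → ℝ) {v : ℝ} (hv : 0 < v)
    (h : mean μ (fun a => F a ^ 2) ≤ v) : mean μ (fun a => |F a|) ≤ √v := by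
  have hs : 0 < √v := Real.sqrt_pos.2 hv
  have h1 : mean μ (fun a => |F a|) ≤ mean μ fun a => (2 * √v)⁻¹ * (F a ^ 2 + v) := by
    refine mean_mono μ fun a _ => ?_
    rw [inv_mul_eq_div, le_div_iff₀ (by positivity)]
    nlinarith [sq_nonneg (|F a| - √v), sq_abs (F a), Real.sq_sqrt hv.le]
  rw [mean_const_mul, mean_add, mean_const] at h1
  refine h1.trans ?_
  rw [inv_mul_eq_div, div_le_iff₀ (by positivity)]
  nlinarith [Real.sq_sqrt hv.le]

end Mean

theorem mean_coin (q : unitInterval) (F : Bool → ℝ) :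
    mean (coin q) F = q * F true + (1 - q) * F false := by
  have h0 : (0 : ℝ) ≤ q := q.2.1
  have h1 : (0 : ℝ) ≤ 1 - q := sub_nonneg.2 q.2.2
  simp [mean, coin, ENNReal.toReal_ofReal, h0, h1]

/-! ### Histories -/

section History

variable {S : Type*} {n t : ℕ}

/-- The first `k` entries of a history. -/
def History.pre (h : History S t) (k : ℕ) (hk : k ≤ t) : History S k :=
  fun j => h (Fin.castLE hk j)

theorem History.pre_snoc (h : History S t) (o : Option (S × Bool)) (k : ℕ) (hk : k ≤ t) :
    History.pre (Fin.snoc h o : History S (t + 1)) k (hk.trans t.le_succ) = h.pre k hk := by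
  funext j
  exact Fin.snoc_castSucc (α := fun _ => Option (S × Bool)) o h (Fin.castLE hk j)

open Classical in
theorem serverMatches_eq_sum (h : History S t) (s : S) :
    (serverMatches h s : ℝ) = ∑ i, if h i = some (s, true) then (1 : ℝ) else 0 := by
  simp [serverMatches]

open Classical in
theorem serverMatches_snoc (h : History S t) (o : Option (S × Bool)) (s : S) :
    serverMatches (Fin.snoc h o : History S (t + 1)) s =
      serverMatches h s + if o = some (s, true) then 1 else 0 := by
  simp only [serverMatches, Finset.card_filter, Fin.sum_univ_castSucc, Fin.snoc_castSucc,
    Fin.snoc_last]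

theorem serverMatches_pre_le (h : History S t) (k : ℕ) (hk : k ≤ t) (s : S) :
    serverMatches (h.pre k hk) s ≤ serverMatches h s := by
  classical
  refine Finset.card_le_card_of_injOn (Fin.castLE hk) ?_ (Fin.castLE_injective hk).injOn
  intro i hi
  simp only [Finset.coe_filter, Finset.mem_univ, true_and, Set.mem_ofPred_eq] at hi ⊢
  exact hi

theorem totalMatches_eq_sum [Fintype S] (h : History S t) :
    (totalMatches h : ℝ) = ∑ s, (serverMatches h s : ℝ) := by
  classical
  simp only [serverMatches_eq_sum]
  rw [Finset.sum_comm]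
  simp only [totalMatches, Finset.card_filter, Nat.cast_sum]
  refine Finset.sum_congr rfl fun i _ => ?_
  rcases h i with _ | ⟨s, _ | _⟩ <;> simp

namespace RewardGraph

variable (G : RewardGraph S n)

open Classical in
/-- The load added to server `s` by the `i`-th entry of a history. -/
def weight (ht : t ≤ n) (h : History S t) (s : S) (i : Fin t) : ℝ :=
  if ∃ x, h i = some (s, x) then (G.p s (Fin.castLE ht i) : ℝ) else 0

theorem load_eq_sum (ht : t ≤ n) (h : History S t) (s : S) :
    G.load ht h s = ∑ i, G.weight ht h s i := rfl

theorem weight_nonneg (ht : t ≤ n) (h : History S t) (s : S) (i : Fin t) :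
    0 ≤ G.weight ht h s i := by
  unfold weight
  split_ifs
  exacts [(G.p _ _).2.1, le_rfl]

theorem weight_le_one (ht : t ≤ n) (h : History S t) (s : S) (i : Fin t) :
    G.weight ht h s i ≤ 1 := by
  unfold weight
  split_ifs
  exacts [(G.p _ _).2.2, zero_le_one]

theorem load_nonneg (ht : t ≤ n) (h : History S t) (s : S) : 0 ≤ G.load ht h s :=
  Finset.sum_nonneg fun i _ => G.weight_nonneg ht h s i

open Classical in
theorem load_snoc (ht : t + 1 ≤ n) (h : History S t) (o : Option (S × Bool)) (s : S) :
    G.load ht (Fin.snoc h o : History S (t + 1)) s =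
      G.load (Nat.le_of_succ_le ht) h s +
        if ∃ x, o = some (s, x) then (G.p s ⟨t, ht⟩ : ℝ) else 0 := by
  simp only [load, Fin.sum_univ_castSucc, Fin.snoc_castSucc, Fin.snoc_last]
  rfl

theorem load_pre (ht : t ≤ n) (h : History S t) (k : ℕ) (hk : k ≤ t) (s : S) :
    G.load (hk.trans ht) (h.pre k hk) s = ∑ j, G.weight ht h s (Fin.castLE hk j) := rfl

theorem load_pre_le (ht : t ≤ n) (h : History S t) (k : ℕ) (hk : k ≤ t) (s : S) :
    G.load (hk.trans ht) (h.pre k hk) s ≤ G.load ht h s := by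
  rw [G.load_pre ht h k hk, load_eq_sum,
    ← Finset.sum_image (f := G.weight ht h s) (Fin.castLE_injective hk).injOn]
  exact Finset.sum_le_sum_of_subset_of_nonneg (Finset.subset_univ _)
    fun i _ _ => G.weight_nonneg ht h s i

/-! ### The law of the history -/

theorem mean_outcome_none [Fintype S] (t : Fin n) (F : Option (S × Bool) → ℝ) :
    mean (G.outcome t none) F = F none := mean_pure _ _

theorem mean_outcome_some [Fintype S] (t : Fin n) (s : S) (F : Option (S × Bool) → ℝ) :
    mean (G.outcome t (some s)) F =
      G.p s t * F (some (s, true)) + (1 - G.p s t) * F (some (s, false)) := by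
  rw [outcome, mean_map, mean_coin]

theorem mean_law_zero [Fintype S] (π : Policy S n) (F : History S 0 → ℝ) :
    mean (G.law π 0 n.zero_le) F = F Fin.elim0 := mean_pure _ _

theorem mean_law_succ [Fintype S] (π : Policy S n) (ht : t + 1 ≤ n) (F : History S (t + 1) → ℝ) :
    mean (G.law π (t + 1) ht) F = mean (G.law π t (Nat.le_of_succ_le ht)) fun h =>
      mean (π ⟨t, ht⟩ h) fun a => mean (G.outcome ⟨t, ht⟩ a) fun o => F (Fin.snoc h o) := by
  simp only [law, mean_bind, mean_map]

/-- One step of a martingale proof: the identity is checked for each possible decision separately,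
so it holds under any policy. -/
theorem mean_law_succ_eq [Fintype S] (π : Policy S n) (ht : t + 1 ≤ n)
    {F : History S (t + 1) → ℝ} {K : History S t → ℝ}
    (h0 : ∀ h, F (Fin.snoc h none) = K h)
    (h1 : ∀ h s, G.p s ⟨t, ht⟩ * F (Fin.snoc h (some (s, true))) +
      (1 - G.p s ⟨t, ht⟩) * F (Fin.snoc h (some (s, false))) = K h) :
    mean (G.law π (t + 1) ht) F = mean (G.law π t (Nat.le_of_succ_le ht)) K := by
  rw [mean_law_succ]
  refine mean_congr _ fun h _ => ?_
  rw [← mean_const (π ⟨t, ht⟩ h) (K h)]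
  refine mean_congr _ fun a _ => ?_
  cases a with
  | none => rw [mean_outcome_none, h0]
  | some s => rw [mean_outcome_some, h1]

theorem mean_law_succ_le [Fintype S] (π : Policy S n) (ht : t + 1 ≤ n)
    {F : History S (t + 1) → ℝ} {K : History S t → ℝ}
    (h0 : ∀ h, F (Fin.snoc h none) ≤ K h)
    (h1 : ∀ h s, G.p s ⟨t, ht⟩ * F (Fin.snoc h (some (s, true))) +
      (1 - G.p s ⟨t, ht⟩) * F (Fin.snoc h (some (s, false))) ≤ K h) :
    mean (G.law π (t + 1) ht) F ≤ mean (G.law π t (Nat.le_of_succ_le ht)) K := by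
  rw [mean_law_succ]
  refine mean_mono _ fun h _ => ?_
  rw [← mean_const (π ⟨t, ht⟩ h) (K h)]
  refine mean_mono _ fun a _ => ?_
  cases a with
  | none => rw [mean_outcome_none]; exact h0 h
  | some s => rw [mean_outcome_some]; exact h1 h s

/-- The number of matches minus the load of a server is a martingale. -/
theorem mean_matches_sub_load [Fintype S] (π : Policy S n) (s : S) (t : ℕ) (ht : t ≤ n) :
    mean (G.law π t ht) (fun h => (serverMatches h s : ℝ) - G.load ht h s) = 0 := by
  induction t with
  | zero => rw [mean_law_zero]; simp [serverMatches, load]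
  | succ t ih =>
    rw [← ih (Nat.le_of_succ_le ht)]
    refine G.mean_law_succ_eq π ht (fun h => ?_) fun h s' => ?_
    · simp [serverMatches_snoc, load_snoc]
    · by_cases hs : s' = s
      · subst hs
        simp [serverMatches_snoc, load_snoc]
        ring
      · simp [serverMatches_snoc, load_snoc, hs]
        ring

theorem mean_load [Fintype S] (π : Policy S n) (s : S) (ht : t ≤ n) :
    mean (G.law π t ht) (fun h => G.load ht h s) =
      mean (G.law π t ht) fun h => (serverMatches h s : ℝ) := by
  have h := G.mean_matches_sub_load π s t ht
  rw [mean_sub] at h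
  linarith

/-- An assignment with probability `p` raises the expected squared deviation by the variance
`p(1-p)` and the load by `p`, so the difference is a supermartingale. -/
theorem mean_matches_sub_load_sq [Fintype S] (π : Policy S n) (s : S) (t : ℕ) (ht : t ≤ n) :
    mean (G.law π t ht)
      (fun h => ((serverMatches h s : ℝ) - G.load ht h s) ^ 2 - G.load ht h s) ≤ 0 := by
  induction t with
  | zero => rw [mean_law_zero]; simp [serverMatches, load]
  | succ t ih =>
    refine le_trans ?_ (ih (Nat.le_of_succ_le ht))
    refine G.mean_law_succ_le π ht (fun h => ?_) fun h s' => ?_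
    · simp [serverMatches_snoc, load_snoc]
    · by_cases hs : s' = s
      · subst hs
        simp [serverMatches_snoc, load_snoc]
        nlinarith [sq_nonneg (G.p s' ⟨t, ht⟩ : ℝ)]
      · simp [serverMatches_snoc, load_snoc, hs]
        apply le_of_eq
        ring

theorem expectedMatches_eq_mean [Fintype S] (π : Policy S n) :
    G.expectedMatches π = mean (G.law π n le_rfl) fun h => ∑ s, G.load le_rfl h s := by
  have h : G.expectedMatches π = mean (G.law π n le_rfl) fun h => (totalMatches h : ℝ) := by
    simp only [expectedMatches, mean]
  rw [h]
  simp only [totalMatches_eq_sum, mean_sum, mean_load]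

theorem exists_of_mem_support_law_succ (π : Policy S n) (ht : t + 1 ≤ n) {h' : History S (t + 1)}
    (hh : h' ∈ (G.law π (t + 1) ht).support) :
    ∃ h ∈ (G.law π t (Nat.le_of_succ_le ht)).support, ∃ o : Option (S × Bool),
      h' = Fin.snoc h o ∧ o.map Prod.fst ∈ (π ⟨t, ht⟩ h).support := by
  simp only [law, PMF.mem_support_bind_iff, PMF.mem_support_map_iff] at hh
  obtain ⟨h, hh, a, ha, o, ho, rfl⟩ := hh
  refine ⟨h, hh, o, rfl, ?_⟩
  cases a with
  | none =>
    simp only [outcome, PMF.support_pure, Set.mem_singleton_iff] at ho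
    subst ho
    exact ha
  | some s =>
    simp only [outcome, PMF.mem_support_map_iff] at ho
    obtain ⟨x, -, rfl⟩ := ho
    exact ha

/-- This makes the rules of a policy, stated for partial histories, applicable to each entry of a
complete history. -/
theorem decision_mem_support (π : Policy S n) (t : ℕ) (ht : t ≤ n) {h : History S t}
    (hh : h ∈ (G.law π t ht).support) (i : Fin t) :
    (h i).map Prod.fst ∈ (π (Fin.castLE ht i) (h.pre i i.isLt.le)).support := by
  induction t with
  | zero => exact i.elim0
  | succ t ih =>
    obtain ⟨h, hmem, o, rfl, ho⟩ := G.exists_of_mem_support_law_succ π ht hh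
    induction i using Fin.lastCases with
    | last =>
      have h1 : History.pre (Fin.snoc h o : History S (t + 1)) t t.le_succ = h :=
        History.pre_snoc h o t le_rfl
      rw [Fin.snoc_last]
      change _ ∈ (π ⟨t, ht⟩ (History.pre (Fin.snoc h o : History S (t + 1)) t t.le_succ)).support
      rwa [h1]
    | cast i =>
      have h1 : History.pre (Fin.snoc h o : History S (t + 1)) i (i.isLt.le.trans t.le_succ) =
        h.pre i i.isLt.le := History.pre_snoc h o i i.isLt.le
      rw [Fin.snoc_castSucc]
      change _ ∈ (π (Fin.castLE (Nat.le_of_succ_le ht) i)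
        (History.pre (Fin.snoc h o : History S (t + 1)) i (i.isLt.le.trans t.le_succ))).support
      rw [h1]
      exact ih _ hmem i

variable {b : ℕ} {π : Policy S n}

theorem IsAdmissible.serverMatches_le {G : RewardGraph S n} (hπ : G.IsAdmissible b π) (t : ℕ)
    (ht : t ≤ n) {h : History S t} (hh : h ∈ (G.law π t ht).support) (s : S) :
    serverMatches h s ≤ b := by
  induction t with
  | zero => simp [serverMatches]
  | succ t ih =>
    obtain ⟨h, hmem, o, rfl, ho⟩ := G.exists_of_mem_support_law_succ π ht hh
    rw [serverMatches_snoc]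
    split_ifs with hs
    · subst hs
      exact (hπ ⟨t, ht⟩ h s ho).2
    · exact ih _ hmem

theorem IsAdmissible.mean_matches_le [Fintype S] {G : RewardGraph S n} (hπ : G.IsAdmissible b π)
    (ht : t ≤ n) (s : S) :
    mean (G.law π t ht) (fun h => (serverMatches h s : ℝ)) ≤ b := by
  rw [← mean_const (G.law π t ht) (b : ℝ)]
  exact mean_mono _ fun h hh => by exact_mod_cast hπ.serverMatches_le t ht hh s

/-- The load itself may exceed `b`, but its mean equals the mean number of matches, which is at most
`b`; this bounds the second moment of the deviation. -/
theorem IsAdmissible.mean_abs_matches_sub_load_le [Fintype S] {G : RewardGraph S n}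
    (hπ : G.IsAdmissible b π) (hb : 0 < b) (ht : t ≤ n) (s : S) :
    mean (G.law π t ht) (fun h => |(serverMatches h s : ℝ) - G.load ht h s|) ≤ √b := by
  refine mean_abs_le_sqrt _ _ (by exact_mod_cast hb) ?_
  have h1 := G.mean_matches_sub_load_sq π s t ht
  have h2 := hπ.mean_matches_le ht s
  rw [mean_sub, mean_load] at h1
  linarith

theorem IsStochasticBalance.isAdmissible {G : RewardGraph S n} (hπ : G.IsStochasticBalance b π) :
    G.IsAdmissible b π := fun t h s hs => (hπ t h (some s) hs).1

/-! ### The stochastic benchmark is at most the non-stochastic one -/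

-- The witness is `m(s,r)`, the probability that `r` is assigned to `s`. Its server sum is the mean
-- load, hence the mean number of matches.
open Classical in
theorem IsAdmissible.expectedMatches_le_opt [Fintype S] {G : RewardGraph S n}
    (hπ : G.IsAdmissible b π) : G.expectedMatches π ≤ G.opt b := by
  refine le_csSup (G.opt_set_bddAbove b) ?_
  set μ := G.law π n le_rfl
  let ind : S → Fin n → History S n → ℝ := fun s r h => if ∃ x, h r = some (s, x) then 1 else 0
  have ind_nonneg : ∀ s r h, 0 ≤ ind s r h := fun s r h => by
    dsimp only [ind]
    split_ifs <;> norm_num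
  have hload : ∀ s, (∑ r : Fin n, if G.Adj s r then (G.p s r : ℝ) * mean μ (ind s r) else 0) =
      mean μ fun h => G.load le_rfl h s := by
    intro s
    simp only [load_eq_sum, mean_sum]
    refine Finset.sum_congr rfl fun r _ => ?_
    by_cases hs : G.Adj s r
    · rw [if_pos hs, ← mean_const_mul]
      refine mean_congr _ fun h _ => ?_
      simp [ind, weight]
    · rw [if_neg hs, ← mean_const μ 0]
      refine mean_congr _ fun h hh => ?_
      rw [weight, if_neg]
      rintro ⟨x, hx⟩
      have h1 := G.decision_mem_support π n le_rfl hh r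
      rw [hx] at h1
      exact hs (hπ _ _ _ h1).1
  refine ⟨fun s r => mean μ (ind s r), ⟨fun s r _ => mean_nonneg _ (ind_nonneg s r), fun s => ?_,
    fun r => ?_⟩, ?_⟩
  · rw [hload, mean_load]
    exact hπ.mean_matches_le le_rfl s
  · calc (∑ s, if G.Adj s r then mean μ (ind s r) else 0) ≤ ∑ s, mean μ (ind s r) := by
          refine Finset.sum_le_sum fun s _ => ?_
          split_ifs
          exacts [le_rfl, mean_nonneg _ (ind_nonneg s r)]
      _ = mean μ fun h => ∑ s, ind s r h := (mean_sum _ _ _).symm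
      _ ≤ mean μ fun _ => 1 := by
          refine mean_mono _ fun h _ => ?_
          dsimp only [ind]
          rcases h r with _ | ⟨s, x⟩ <;> simp
      _ = 1 := mean_const _ _
  · rw [expectedMatches_eq_mean, mean_sum, lpValue]
    exact Finset.sum_congr rfl fun s _ => (hload s).symm

theorem sopt_le_opt [Fintype S] (b : ℕ) : G.sopt b ≤ G.opt b := by
  refine csSup_le (G.sopt_set_nonempty b) ?_
  rintro v ⟨π, hπ, rfl⟩
  exact hπ.expectedMatches_le_opt

end RewardGraph

end History

/-! ### The balance function -/

section BalanceFun

variable {b : ℕ}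

theorem balanceFun_eq_min (hb : 0 < b) (x : ℝ) :
    balanceFun b x = min (Real.exp (x / b - 1)) 1 := by
  have hb' : (0 : ℝ) < b := by exact_mod_cast hb
  unfold balanceFun
  split_ifs with h
  · rw [min_eq_left]
    rw [Real.exp_le_one_iff, sub_nonpos, div_le_one hb']
    exact h
  · rw [min_eq_right]
    rw [Real.one_le_exp_iff, sub_nonneg, one_le_div hb']
    exact (not_le.1 h).le

theorem balanceFun_nonneg (hb : 0 < b) (x : ℝ) : 0 ≤ balanceFun b x := by
  rw [balanceFun_eq_min hb]
  positivity

theorem balanceFun_le_one (hb : 0 < b) (x : ℝ) : balanceFun b x ≤ 1 := by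
  rw [balanceFun_eq_min hb]
  exact min_le_right _ _

theorem balanceFun_mono (hb : 0 < b) : Monotone (balanceFun b) := by
  intro x y h
  rw [balanceFun_eq_min hb, balanceFun_eq_min hb]
  gcongr

theorem balanceFun_zero : balanceFun b 0 = Real.exp (-1) := by
  simp [balanceFun]

/-- A discrete form of `b f' = f`: for `u = w/b`, `e^u - 1 ≤ u e^u`, and the prefactor `e^(-1/b)`
absorbs `e^u` as `w ≤ 1`. Beyond `b` the function is constant. -/
theorem balanceFun_add_sub_le (hb : 0 < b) (x : ℝ) {w : ℝ} (h0 : 0 ≤ w) (h1 : w ≤ 1) :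
    b * Real.exp (-(1 / b)) * (balanceFun b (x + w) - balanceFun b x) ≤ w * balanceFun b x := by
  have hb' : (0 : ℝ) < b := by exact_mod_cast hb
  rcases le_or_gt x b with hx | hx
  · have h2 : balanceFun b (x + w) ≤ balanceFun b x * Real.exp (w / b) := by
      rw [balanceFun_eq_min hb (x + w)]
      refine (min_le_left _ _).trans_eq ?_
      rw [balanceFun, if_pos hx, ← Real.exp_add]
      ring_nf
    have h3 : Real.exp (w / b) * (1 - w / b) ≤ 1 := by
      have h4 := Real.add_one_le_exp (-(w / b))
      calc _ ≤ Real.exp (w / b) * Real.exp (-(w / b)) := by gcongr; linarith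
        _ = 1 := by rw [← Real.exp_add]; simp
    have h4 : Real.exp (-(1 / b)) * Real.exp (w / b) ≤ 1 := by
      rw [← Real.exp_add, Real.exp_le_one_iff]
      have : w / b ≤ 1 / b := by gcongr
      linarith
    have h5 : 0 ≤ balanceFun b x := balanceFun_nonneg hb x
    have h6 : 0 ≤ w / b := by positivity
    calc _ ≤ b * Real.exp (-(1 / b)) * (balanceFun b x * (Real.exp (w / b) * (w / b))) := by
          gcongr
          nlinarith
      _ = (Real.exp (-(1 / b)) * Real.exp (w / b)) * (w * balanceFun b x) := by
          field_simp
      _ ≤ 1 * (w * balanceFun b x) := by gcongr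
      _ = _ := one_mul _
  · have h2 : balanceFun b x = 1 := by rw [balanceFun, if_neg (not_le.2 hx)]
    have h3 : balanceFun b (x + w) = 1 := by
      rw [balanceFun, if_neg (not_le.2 (by linarith))]
    simp [h2, h3, h0]

/-- The increments telescope from `f(0) = e⁻¹`. -/
theorem balanceFun_sum_le (hb : 0 < b) (t : ℕ) (w : Fin t → ℝ) (h0 : ∀ i, 0 ≤ w i)
    (h1 : ∀ i, w i ≤ 1) :
    b * Real.exp (-(1 / b)) * (balanceFun b (∑ i, w i) - Real.exp (-1)) ≤
      ∑ i : Fin t, w i * balanceFun b (∑ j : Fin i, w (Fin.castLE i.isLt.le j)) := by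
  induction t with
  | zero => simp [balanceFun_zero]
  | succ t ih =>
    have h2 := ih (fun i => w i.castSucc) (fun i => h0 _) fun i => h1 _
    have h3 := balanceFun_add_sub_le hb (∑ i : Fin t, w i.castSucc) (h0 (Fin.last t))
      (h1 (Fin.last t))
    rw [Fin.sum_univ_castSucc, Fin.sum_univ_castSucc]
    refine le_trans ?_ (add_le_add h2 h3)
    apply le_of_eq
    ring

theorem one_sub_le_balanceFun (hb : 0 < b) (x : ℝ) : 1 - |b - x| / b ≤ balanceFun b x := by
  have hb' : (0 : ℝ) < b := by exact_mod_cast hb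
  rw [balanceFun_eq_min hb]
  refine le_min ?_ (sub_le_self _ (by positivity))
  have h1 := Real.add_one_le_exp (x / b - 1)
  have h2 : (b - x) / b ≤ |b - x| / b := by gcongr; exact le_abs_self _
  rw [sub_div, div_self hb'.ne'] at h2
  linarith

end BalanceFun

/-! ### The dual solution -/

namespace RewardGraph

variable {S : Type*} {n b : ℕ} {π : Policy S n} (G : RewardGraph S n)

/-- The dual variable of server `s`. -/
def serverDual (b : ℕ) (h : History S n) (s : S) : ℝ :=
  (∑ i : Fin n, G.weight le_rfl h s i *
    balanceFun b (G.load i.isLt.le (h.pre i i.isLt.le) s)) / b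

/-- The dual variable of request `r`. -/
def requestDual [Fintype S] (b : ℕ) (h : History S n) (r : Fin n) : ℝ :=
  ∑ s, G.weight le_rfl h s r * (1 - balanceFun b (G.load r.isLt.le (h.pre r r.isLt.le) s))

theorem serverDual_nonneg (hb : 0 < b) (h : History S n) (s : S) : 0 ≤ G.serverDual b h s :=
  div_nonneg (Finset.sum_nonneg fun _ _ =>
    mul_nonneg (G.weight_nonneg _ _ _ _) (balanceFun_nonneg hb _)) b.cast_nonneg

theorem requestDual_nonneg [Fintype S] (hb : 0 < b) (h : History S n) (r : Fin n) :
    0 ≤ G.requestDual b h r :=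
  Finset.sum_nonneg fun _ _ =>
    mul_nonneg (G.weight_nonneg _ _ _ _) (sub_nonneg.2 (balanceFun_le_one hb _))

theorem dual_value [Fintype S] (hb : 0 < b) (h : History S n) :
    ∑ s, b * G.serverDual b h s + ∑ r, G.requestDual b h r = ∑ s, G.load le_rfl h s := by
  have hb' : (b : ℝ) ≠ 0 := by exact_mod_cast hb.ne'
  simp only [serverDual, requestDual, mul_div_cancel₀ _ hb']
  rw [Finset.sum_comm (s := (Finset.univ : Finset (Fin n))), ← Finset.sum_add_distrib]
  refine Finset.sum_congr rfl fun s _ => ?_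
  rw [← Finset.sum_add_distrib, load_eq_sum]
  refine Finset.sum_congr rfl fun i _ => ?_
  ring

/-- As `e^(-1/b) ≥ 1 - 1/b` and `f - 1/e` lies in `[0,1]`, the multiplicative loss costs at most
`1/b` additively. -/
theorem le_serverDual (hb : 0 < b) (h : History S n) (s : S) :
    balanceFun b (G.load le_rfl h s) - Real.exp (-1) - 1 / b ≤ G.serverDual b h s := by
  have hb' : (0 : ℝ) < b := by exact_mod_cast hb
  have h1 := balanceFun_sum_le hb n (G.weight le_rfl h s) (G.weight_nonneg le_rfl h s)
    (G.weight_le_one le_rfl h s)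
  have h2 : Real.exp (-(1 / b)) * (balanceFun b (G.load le_rfl h s) - Real.exp (-1)) ≤
      G.serverDual b h s := by
    rw [serverDual, le_div_iff₀ hb']
    calc _ = b * Real.exp (-(1 / b)) * (balanceFun b (G.load le_rfl h s) - Real.exp (-1)) := by
          ring
      _ ≤ _ := h1
  refine le_trans ?_ h2
  have h3 := Real.add_one_le_exp (-(1 / b) : ℝ)
  have h4 := balanceFun_le_one hb (G.load le_rfl h s)
  have h5 : Real.exp (-1) ≤ balanceFun b (G.load le_rfl h s) := by
    rw [← balanceFun_zero (b := b)]
    exact balanceFun_mono hb (G.load_nonneg _ _ _)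
  have h6 : (0 : ℝ) < 1 / b := by positivity
  have h7 := Real.exp_pos (-1)
  nlinarith

theorem requestDual_eq [Fintype S] {h : History S n} {r : Fin n} {s : S} {x : Bool}
    (hr : h r = some (s, x)) : G.requestDual b h r =
      G.p s r * (1 - balanceFun b (G.load r.isLt.le (h.pre r r.isLt.le) s)) := by
  classical
  rw [requestDual, Finset.sum_eq_single s]
  · simp [weight, hr]
  · intro s' _ hs
    simp [weight, hr, hs.symm]
  · simp

/-- The dual constraints hold up to the deviation of the number of matches from the load. -/
theorem IsStochasticBalance.dual_constraint [Fintype S] {G : RewardGraph S n}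
    (hπ : G.IsStochasticBalance b π) (hb : 0 < b) {h : History S n}
    (hh : h ∈ (G.law π n le_rfl).support) {s : S} {r : Fin n} (hs : G.Adj s r) :
    G.p s r * (1 - Real.exp (-1) - 1 / b - |(serverMatches h s : ℝ) - G.load le_rfl h s| / b) ≤
      G.p s r * G.serverDual b h s + G.requestDual b h r := by
  have hp : (0 : ℝ) ≤ G.p s r := (G.p s r).2.1
  have hx := G.le_serverDual hb h s
  -- For an available `s`, the greedy choice yields at least `p (1 - f)` at the load seen by `r`.
  -- The final load is no smaller, so the terms in `f` cancel favourably.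
  by_cases hav : s ∈ G.available b r (h.pre r r.isLt.le)
  · have h1 : G.p s r * (1 - balanceFun b (G.load r.isLt.le (h.pre r r.isLt.le) s)) ≤
        G.requestDual b h r := by
      have h2 := hπ _ _ _ (G.decision_mem_support π n le_rfl hh r)
      rcases hr : h r with _ | ⟨s', x⟩
      · rw [hr] at h2
        exact absurd hav (Set.eq_empty_iff_forall_notMem.1 h2 s)
      · rw [hr] at h2
        rw [G.requestDual_eq hr]
        exact h2.2 s hav
    have h3 := balanceFun_mono hb (G.load_pre_le le_rfl h r r.isLt.le s)
    have h4 : 0 ≤ |(serverMatches h s : ℝ) - G.load le_rfl h s| / b := by positivity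
    refine le_trans ?_ (add_le_add_right h1 _)
    rw [← mul_add]
    refine mul_le_mul_of_nonneg_left ?_ hp
    linarith
  -- An exhausted server stays exhausted, and its own dual variable suffices up to the deviation.
  · have h1 : b ≤ serverMatches (h.pre r r.isLt.le) s := by
      by_contra hlt
      exact hav ⟨hs, not_le.1 hlt⟩
    have h2 : serverMatches h s = b :=
      le_antisymm (hπ.isAdmissible.serverMatches_le n le_rfl hh s)
        (h1.trans (serverMatches_pre_le h r r.isLt.le s))
    have h3 := one_sub_le_balanceFun hb (G.load le_rfl h s)
    rw [h2]
    refine le_trans (mul_le_mul_of_nonneg_left ?_ hp)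
      (le_add_of_nonneg_right (G.requestDual_nonneg hb h r))
    linarith

/-- Weak duality for the averaged dual variables. The constraints are only multiplied by `m ≥ 0`, so
the leading factor may be negative. -/
theorem IsStochasticBalance.mul_lpValue_le [Fintype S] {G : RewardGraph S n}
    (hπ : G.IsStochasticBalance b π) (hb : 0 < b) {m : S → Fin n → ℝ} (hm : G.IsFeasible b m) :
    (1 - Real.exp (-1) - 1 / b - √b / b) * G.lpValue m ≤ G.expectedMatches π := by
  classical
  have hb' : (0 : ℝ) < b := by exact_mod_cast hb
  set μ := G.law π n le_rfl
  set X : S → ℝ := fun s => mean μ fun h => G.serverDual b h s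
  set Y : Fin n → ℝ := fun r => mean μ fun h => G.requestDual b h r
  have hX : ∀ s, 0 ≤ X s := fun s => mean_nonneg _ fun h => G.serverDual_nonneg hb h s
  have hY : ∀ r, 0 ≤ Y r := fun r => mean_nonneg _ fun h => G.requestDual_nonneg hb h r
  have hc : ∀ s r, G.Adj s r →
      G.p s r * (1 - Real.exp (-1) - 1 / b - √b / b) ≤ G.p s r * X s + Y r := by
    intro s r hs
    have h1 := mean_mono μ fun h hh => hπ.dual_constraint hb hh hs
    simp only [mean_add, mean_const_mul, mean_sub, mean_const, div_eq_inv_mul _ (b : ℝ)] at h1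
    refine le_trans (mul_le_mul_of_nonneg_left ?_ (G.p s r).2.1) h1
    have h2 : (b : ℝ)⁻¹ * mean μ (fun h => |(serverMatches h s : ℝ) - G.load le_rfl h s|) ≤
        (b : ℝ)⁻¹ * √b :=
      mul_le_mul_of_nonneg_left (hπ.isAdmissible.mean_abs_matches_sub_load_le hb le_rfl s)
        (by positivity)
    simp only [div_eq_inv_mul]
    linarith
  have hval : ∑ s, b * X s + ∑ r, Y r = G.expectedMatches π := by
    rw [expectedMatches_eq_mean]
    simp only [← G.dual_value hb, mean_add, mean_sum, mean_const_mul]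
    rfl
  rw [← hval]
  calc (1 - Real.exp (-1) - 1 / b - √b / b) * G.lpValue m
      ≤ ∑ s, ∑ r : Fin n, ((if G.Adj s r then (G.p s r : ℝ) * m s r else 0) * X s +
          (if G.Adj s r then m s r else 0) * Y r) := by
        simp only [lpValue, Finset.mul_sum]
        refine Finset.sum_le_sum fun s _ => Finset.sum_le_sum fun r _ => ?_
        split_ifs with hs
        · have h1 := mul_le_mul_of_nonneg_left (hc s r hs) (hm.nonneg s r hs)
          linarith
        · simp
    _ = ∑ s, (∑ r : Fin n, if G.Adj s r then (G.p s r : ℝ) * m s r else 0) * X s +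
          ∑ r, (∑ s, if G.Adj s r then m s r else 0) * Y r := by
        simp only [Finset.sum_add_distrib, Finset.sum_mul]
        congr 1
        exact Finset.sum_comm
    _ ≤ ∑ s, b * X s + ∑ r, Y r := by
        refine add_le_add (Finset.sum_le_sum fun s _ => ?_) (Finset.sum_le_sum fun r _ => ?_)
        · exact mul_le_mul_of_nonneg_right (hm.server s) (hX s)
        · exact mul_le_of_le_one_left (hY r) (hm.request r)

/-- The maximum with `0` covers small `b`, where the duality factor may be negative and the claim is
trivial. -/
theorem IsStochasticBalance.mul_opt_le [Fintype S] {G : RewardGraph S n}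
    (hπ : G.IsStochasticBalance b π) (hb : 0 < b) {c : ℝ} (hc : 0 ≤ c)
    (h : c ≤ max 0 (1 - Real.exp (-1) - 1 / b - √b / b)) :
    c * G.opt b ≤ G.expectedMatches π := by
  rcases le_max_iff.1 h with h0 | h0
  · obtain rfl : c = 0 := le_antisymm h0 hc
    rw [zero_mul, expectedMatches_eq_mean]
    exact mean_nonneg _ fun h => Finset.sum_nonneg fun s _ => G.load_nonneg _ _ _
  · rcases hc.eq_or_lt with rfl | hc'
    · rw [zero_mul, expectedMatches_eq_mean]
      exact mean_nonneg _ fun h => Finset.sum_nonneg fun s _ => G.load_nonneg _ _ _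
    · rw [← le_div_iff₀' hc']
      refine csSup_le (G.opt_set_nonempty b) ?_
      rintro v ⟨m, hm, rfl⟩
      rw [le_div_iff₀' hc']
      refine le_trans (mul_le_mul_of_nonneg_right h0 ?_) (hπ.mul_lpValue_le hb hm)
      classical
      refine Finset.sum_nonneg fun s _ => Finset.sum_nonneg fun r _ => ?_
      split_ifs with hs
      exacts [mul_nonneg (G.p s r).2.1 (hm.nonneg s r hs), le_rfl]

end RewardGraph

end StochasticMatching

end

/-! ### The error sequence and the conclusion -/

theorem mainTheorem3 :
    ∃ ε : ℕ → ℝ, Filter.Tendsto ε Filter.atTop (nhds 0) ∧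
      ∀ (b : ℕ), 0 < b → ∀ (S : Type*) [Fintype S] (n : ℕ) (G : StochasticMatching.RewardGraph S n)
        (π : StochasticMatching.Policy S n), G.IsStochasticBalance b π →
        (1 - ε b) * (1 - 1 / Real.exp 1) * G.opt b ≤ G.expectedMatches π ∧
        (1 - ε b) * (1 - 1 / Real.exp 1) * G.sopt b ≤ G.expectedMatches π := by
  have hκ : (0 : ℝ) < 1 - Real.exp (-1) := sub_pos.2 (by simp)
  -- Uncapped, this value makes `(1 - ε)(1 - 1/e)` equal to the duality factor. The cap at `1` keeps
  -- the product nonnegative, as needed to replace `opt` by the smaller `sopt`.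
  refine ⟨fun b => min 1 ((1 / b + √b / b) / (1 - Real.exp (-1))), ?_, ?_⟩
  · have h1 : Filter.Tendsto (fun b : ℕ => (1 : ℝ) / b) Filter.atTop (nhds 0) :=
      tendsto_one_div_atTop_nhds_zero_nat
    have h2 : Filter.Tendsto (fun b : ℕ => √(b : ℝ) / b) Filter.atTop (nhds 0) := by
      simp only [Real.sqrt_div_self]
      simpa [Function.comp_def] using
        (Real.continuous_sqrt.tendsto 0).comp (tendsto_inv_atTop_nhds_zero_nat (𝕜 := ℝ))
    simpa using (tendsto_const_nhds (x := (1 : ℝ))).min ((h1.add h2).div_const (1 - Real.exp (-1)))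
  · intro b hb S _ n G π hπ
    rw [one_div, ← Real.exp_neg]
    set e : ℝ := (1 / b + √b / b) / (1 - Real.exp (-1)) with he
    have he' : e * (1 - Real.exp (-1)) = 1 / b + √b / b := div_mul_cancel₀ _ hκ.ne'
    have hc : 0 ≤ (1 - min 1 e) * (1 - Real.exp (-1)) :=
      mul_nonneg (sub_nonneg.2 (min_le_left _ _)) hκ.le
    have h : (1 - min 1 e) * (1 - Real.exp (-1)) * G.opt b ≤ G.expectedMatches π := by
      refine hπ.mul_opt_le hb hc ?_
      rcases le_total 1 e with h1 | h1
      · rw [min_eq_left h1]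
        simp
      · rw [min_eq_right h1]
        refine le_max_of_le_right ?_
        linarith
    exact ⟨h, (mul_le_mul_of_nonneg_left (G.sopt_le_opt b) hc).trans h⟩
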